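/- Let $P$ be a smooth $N$-dimensional manifold, let $1\le n\le N$, and let $\hat\omega=\omega^\alpha\otimes\hat r_\alpha$ be a general $n$-symplectic (polysymplectic) structure on $P$, i.e. a smooth $\mathbb R^n$-valued 2-form ($\hat r_1,\dots,\hat r_n$ the standard basis of $\mathbb R^n$) with $d\omega^\alpha=0$ for all $\alpha$ and with $v\lrcorner\hat\omega=0\iff v=0$ for every tangent vector $v$. Round brackets around indices denote symmetrization (the average over all permutations of the enclosed indices), and $\otimes_s^k\mathbb R^n$ is the space of symmetric tensors, with $\otimes_s^0\mathbb R^n=\mathbb R$. For $p\ge 1$, call a smooth $\otimes_s^{p-1}\mathbb R^n$-valued vector field $X=(X^{\alpha_1\dots\alpha_{p-1}})$ on $P$ Hamiltonian of rank $p$ if there is a smooth function $\hat f=(\hat f^{\alpha_1\dots\alpha_p}):P\to\otimes_s^p\mathbb R^n$ with $$d\hat f^{\alpha_1\dots\alpha_p}=-p!\,X^{(\alpha_1\dots\alpha_{p-1}}\lrcorner\,\omega^{\alpha_p)} .$$ Two Hamiltonian vector fields of rank $p$ are equivalent if their difference $Y$ satisfies $Y^{(\alpha_1\dots\alpha_{p-1}}\lrcorner\,\omega^{\alpha_p)}=0$.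 Let $[\![X]\!]$ denote the equivalence class of $X$, let $SHV^p$ be the real vector space of these classes, and let $SHV=\bigoplus_{p\ge1}SHV^p$. Theorem. Let $p,q\ge 1$. If $X$ and $Z$ are Hamiltonian of rank $p$ and $q$, then the $\otimes_s^{p+q-2}\mathbb R^n$-valued vector field with components $$[X^{(\alpha_1\dots\alpha_{p-1}},\,Z^{\alpha_p\dots\alpha_{p+q-2})}]$$ (Lie brackets of vector fields, symmetrized over all upper indices) is Hamiltonian of rank $p+q-1$, and its class depends only on $[\![X]\!]$ and $[\![Z]\!]$. Hence $[\![X]\!],[\![Z]\!]\mapsto \big[\!\big[\,[X^{(\alpha_1\dots\alpha_{p-1}},Z^{\alpha_p\dots\alpha_{p+q-2})}]\,\hat r_{\alpha_1}\otimes_s\cdots\otimes_s\hat r_{\alpha_{p+q-2}}\big]\!\big]$ is a well-defined map $SHV^p\times SHV^q\to SHV^{p+q-1}$; these maps are the homogeneous parts of a unique bilinear bracket $[\![\ ,\ ]\!]$ on $SHV$, and $(SHV,[\![\ ,\ ]\!])$ is a real Lie algebra: the bracket is alternating and satisfies the Jacobi identity. -/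

import Mathlib

open scoped Manifold ContDiff DirectSum Nat
open VectorField

noncomputable section

namespace NSymplectic

/-! ### Index symmetrization -/

/-- Symmetrization over all `m` indices of a family `T^{α₁ … α_m}` with `αᵢ ∈ {1, …, n}`:
`T^{(α₁ … α_m)} = (1 / m!) ∑_σ T^{α_{σ 1} … α_{σ m}}`. -/
def symmetrize {n m : ℕ} {V : Type*} [AddCommGroup V] [Module ℝ V]
    (T : (Fin m → Fin n) → V) (J : Fin m → Fin n) : V :=
  ((m ! : ℝ)⁻¹) • ∑ σ : Equiv.Perm (Fin m), T (J ∘ σ)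

/-- A family `T^{α₁ … α_m}` that is invariant under permutations of its indices; these are
the components of an element of `⊗ₛ^m ℝⁿ ⊗ V`. -/
def IsSymmetric {n m : ℕ} {V : Type*} (T : (Fin m → Fin n) → V) : Prop :=
  ∀ (σ : Equiv.Perm (Fin m)) (J : Fin m → Fin n), T (J ∘ σ) = T J

lemma symmetrize_add {n m : ℕ} {V : Type*} [AddCommGroup V] [Module ℝ V]
    (S T : (Fin m → Fin n) → V) (J : Fin m → Fin n) :
    symmetrize (fun J => S J + T J) J = symmetrize S J + symmetrize T J := by
  simp [symmetrize, Finset.sum_add_distrib]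

lemma symmetrize_smul {n m : ℕ} {V : Type*} [AddCommGroup V] [Module ℝ V]
    (c : ℝ) (T : (Fin m → Fin n) → V) (J : Fin m → Fin n) :
    symmetrize (fun J => c • T J) J = c • symmetrize T J := by
  simp only [symmetrize, ← Finset.smul_sum]
  rw [smul_comm]

/-! ### Smooth vector fields, functions and 2-forms on an `N`-dimensional manifold -/

/-- Smooth vector fields on the `N`-dimensional manifold `P`. -/
abbrev VField (N : ℕ) (P : Type*) [TopologicalSpace P]
    [ChartedSpace (EuclideanSpace ℝ (Fin N)) P] [IsManifold (𝓡 N) ∞ P] : Type _ :=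
  ContMDiffSection (𝓡 N) (EuclideanSpace ℝ (Fin N)) ∞ (TangentSpace (𝓡 N) : P → Type _)

variable {N n : ℕ} {P : Type*} [TopologicalSpace P]
  [ChartedSpace (EuclideanSpace ℝ (Fin N)) P]

/-- The ordinary Lie bracket of two smooth vector fields. -/
def lieBr [IsManifold (𝓡 N) ∞ P] (X Y : VField N P) : VField N P where
  toFun := mlieBracket (𝓡 N) X Y
  contMDiff_toFun := by
    have : IsManifold (𝓡 N) (((⊤ : ℕ∞) : WithTop ℕ∞) + 1) P := by
      simpa using (inferInstance : IsManifold (𝓡 N) ∞ P)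
    have : IsManifold (𝓡 N) (minSmoothness ℝ 2) P :=
      IsManifold.of_le (n := ∞) (by simpa using ENat.LEInfty.out)
    have : IsManifold (𝓡 N) (minSmoothness ℝ 3) P :=
      IsManifold.of_le (n := ∞) (by simpa using ENat.LEInfty.out)
    exact ContDiff.mlieBracket_vectorField (n := ⊤) (m := ⊤) X.contMDiff Y.contMDiff (by simp)

/-- The differential `df` of a smooth function, evaluated at the tangent vector `v`. -/
def differential (f : C^∞⟮𝓡 N, P; ℝ⟯) (x : P) (v : TangentSpace (𝓡 N) x) : ℝ :=
  NormedSpace.fromTangentSpace (f x) (mfderiv (𝓡 N) 𝓘(ℝ, ℝ) f x v)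

lemma differential_add (f g : C^∞⟮𝓡 N, P; ℝ⟯) (x : P) (v : TangentSpace (𝓡 N) x) :
    differential (f + g) x v = differential f x v + differential g x v := by
  have hf : MDifferentiableAt (𝓡 N) 𝓘(ℝ, ℝ) f x :=
    f.contMDiff.mdifferentiableAt (by simp)
  have hg : MDifferentiableAt (𝓡 N) 𝓘(ℝ, ℝ) g x :=
    g.contMDiff.mdifferentiableAt (by simp)
  have h := (hf.hasMFDerivAt.add hg.hasMFDerivAt).mfderiv
  have h' := DFunLike.congr_fun h v
  exact h'

lemma differential_smul (c : ℝ) (f : C^∞⟮𝓡 N, P; ℝ⟯) (x : P) (v : TangentSpace (𝓡 N) x) :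
    differential (c • f) x v = c * differential f x v := by
  have hf : MDifferentiableAt (𝓡 N) 𝓘(ℝ, ℝ) f x :=
    f.contMDiff.mdifferentiableAt (by simp)
  have h := (hf.hasMFDerivAt.const_smul c).mfderiv
  have h' := DFunLike.congr_fun h v
  exact h'

/-- A (not necessarily continuous) differential 2-form on `P`. -/
abbrev TwoForm (N : ℕ) (P : Type*) [TopologicalSpace P]
    [ChartedSpace (EuclideanSpace ℝ (Fin N)) P] : Type _ :=
  ∀ x : P, TangentSpace (𝓡 N) x [⋀^Fin 2]→L[ℝ] ℝ

/-- The local representative of a 2-form in the chart around `x₀`: its pullback along the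
inverse of the chart. It is meaningful on the target of the chart. -/
def chartForm (Ω : TwoForm N P) (x₀ : P) (y : EuclideanSpace ℝ (Fin N)) :
    EuclideanSpace ℝ (Fin N) [⋀^Fin 2]→L[ℝ] ℝ :=
  (Ω ((extChartAt (𝓡 N) x₀).symm y)).compContinuousLinearMap
    (mfderiv 𝓘(ℝ, EuclideanSpace ℝ (Fin N)) (𝓡 N) (extChartAt (𝓡 N) x₀).symm y)

/-- A 2-form is smooth if all its local representatives are. -/
def TwoForm.IsSmooth (Ω : TwoForm N P) : Prop :=
  ∀ x₀ : P, ContDiffOn ℝ ∞ (chartForm Ω x₀) (extChartAt (𝓡 N) x₀).target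

/-- A (smooth) 2-form is closed if the exterior derivatives of all its local representatives
vanish. -/
def TwoForm.IsClosed (Ω : TwoForm N P) : Prop :=
  ∀ x₀ : P, ∀ y ∈ (extChartAt (𝓡 N) x₀).target, extDeriv (chartForm Ω x₀) y = 0

variable (N n P) in
/-- A general `n`-symplectic (polysymplectic) structure on `P`: an `ℝⁿ`-valued smooth 2-form
`ω̂ = ω^α ⊗ r̂_α`, given by its components, with `dω^α = 0` for all `α`, and with
`v ⌟ ω̂ = 0 ↔ v = 0` for all tangent vectors `v`. -/
structure Structure where
  /-- the components `ω^α` -/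
  form : Fin n → TwoForm N P
  smooth : ∀ α, (form α).IsSmooth
  closed : ∀ α, (form α).IsClosed
  nondegenerate : ∀ (x : P) (v : TangentSpace (𝓡 N) x),
    (∀ (α : Fin n) (w : TangentSpace (𝓡 N) x), form α x ![v, w] = 0) ↔ v = 0

/-! ### Generalized Hamiltonian vector fields

The rank is `p = k + 1` throughout, so that a rank `p` Hamiltonian vector field is
`⊗ₛ^k ℝⁿ`-valued; it is given by its components `X^{α₁ … α_k}`. -/

variable [IsManifold (𝓡 N) ∞ P]

/-- The components `(X^{(α₁ … α_k} ⌟ ω^{α_{k+1})})(v)` of the symmetrized interior product. -/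
def symContract (Ω : Structure N n P) {k : ℕ} (X : (Fin k → Fin n) → VField N P)
    (J : Fin (k + 1) → Fin n) (x : P) (v : TangentSpace (𝓡 N) x) : ℝ :=
  symmetrize
    (fun K : Fin (k + 1) → Fin n => Ω.form (K (Fin.last k)) x ![X (Fin.init K) x, v]) J

/-- The structure equation
`d f^{α₁ … α_p} = - p! X^{(α₁ … α_{p-1}} ⌟ ω^{α_p)}`, with `p = k + 1`. -/
def StructureEq (Ω : Structure N n P) {k : ℕ} (f : (Fin (k + 1) → Fin n) → C^∞⟮𝓡 N, P; ℝ⟯)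
    (X : (Fin k → Fin n) → VField N P) : Prop :=
  ∀ (J : Fin (k + 1) → Fin n) (x : P) (v : TangentSpace (𝓡 N) x),
    differential (f J) x v = -((k + 1)! : ℝ) * symContract Ω X J x v

lemma symContract_add (Ω : Structure N n P) {k : ℕ} (X Y : (Fin k → Fin n) → VField N P)
    (J : Fin (k + 1) → Fin n) (x : P) (v : TangentSpace (𝓡 N) x) :
    symContract Ω (X + Y) J x v = symContract Ω X J x v + symContract Ω Y J x v := by
  unfold symContract
  rw [← symmetrize_add]
  congr 1
  funext K
  exact (Ω.form (K (Fin.last k)) x).toAlternatingMap.map_vecCons_add ![v] _ _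

lemma symContract_smul (Ω : Structure N n P) {k : ℕ} (c : ℝ)
    (X : (Fin k → Fin n) → VField N P)
    (J : Fin (k + 1) → Fin n) (x : P) (v : TangentSpace (𝓡 N) x) :
    symContract Ω (c • X) J x v = c * symContract Ω X J x v := by
  unfold symContract
  rw [← smul_eq_mul, ← symmetrize_smul]
  congr 1
  funext K
  exact (Ω.form (K (Fin.last k)) x).toAlternatingMap.map_vecCons_smul ![v] _ _

lemma symContract_zero (Ω : Structure N n P) {k : ℕ}
    (J : Fin (k + 1) → Fin n) (x : P) (v : TangentSpace (𝓡 N) x) :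
    symContract Ω (0 : (Fin k → Fin n) → VField N P) J x v = 0 := by
  simpa using symContract_smul Ω (0 : ℝ) (0 : (Fin k → Fin n) → VField N P) J x v

/-- The space of all `⊗ₛ^k ℝⁿ`-valued vector fields that satisfy the structure equation for some
smooth `⊗ₛ^{k+1} ℝⁿ`-valued function `f`. -/
def HVF (Ω : Structure N n P) (k : ℕ) : Submodule ℝ ((Fin k → Fin n) → VField N P) where
  carrier := {X | IsSymmetric X ∧
    ∃ f : (Fin (k + 1) → Fin n) → C^∞⟮𝓡 N, P; ℝ⟯, IsSymmetric f ∧ StructureEq Ω f X}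
  add_mem' := by
    rintro X Y ⟨hX, f, hf, hfX⟩ ⟨hY, g, hg, hgY⟩
    refine ⟨fun σ J => ?_, f + g, fun σ J => ?_, fun J x v => ?_⟩
    · simp [hX σ J, hY σ J]
    · simp [hf σ J, hg σ J]
    · rw [Pi.add_apply, differential_add, symContract_add, hfX J x v, hgY J x v, mul_add]
  zero_mem' := by
    refine ⟨fun σ J => rfl, 0, fun σ J => rfl, fun J x v => ?_⟩
    rw [symContract_zero, mul_zero]
    simpa using differential_smul (0 : ℝ) (0 : C^∞⟮𝓡 N, P; ℝ⟯) x v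
  smul_mem' := by
    rintro c X ⟨hX, f, hf, hfX⟩
    refine ⟨fun σ J => ?_, c • f, fun σ J => ?_, fun J x v => ?_⟩
    · simp [hX σ J]
    · simp [hf σ J]
    · rw [Pi.smul_apply, differential_smul, symContract_smul, hfX J x v]
      ring

/-- The solutions `Y` of the kernel equation `Y^{(α₁ … α_k} ⌟ ω^{α_{k+1})} = 0`. -/
def kernelEq (Ω : Structure N n P) (k : ℕ) :
    Submodule ℝ ((Fin k → Fin n) → VField N P) where
  carrier := {Y | ∀ (J : Fin (k + 1) → Fin n) (x : P) (v : TangentSpace (𝓡 N) x),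
    symContract Ω Y J x v = 0}
  add_mem' := by
    intro X Y hX hY J x v
    rw [symContract_add, hX J x v, hY J x v, add_zero]
  zero_mem' := fun J x v => symContract_zero Ω J x v
  smul_mem' := by
    intro c X hX J x v
    rw [symContract_smul, hX J x v, mul_zero]

/-- The space `SHV^{k+1}` of generalized rank `k + 1` Hamiltonian vector fields: equivalence
classes of Hamiltonian `⊗ₛ^k ℝⁿ`-valued vector fields modulo solutions of the kernel equation. -/
abbrev SHVrank (Ω : Structure N n P) (k : ℕ) : Type _ :=
  HVF Ω k ⧸ (kernelEq Ω k).submoduleOf (HVF Ω k)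

/-- The equivalence class of a Hamiltonian `⊗ₛ^k ℝⁿ`-valued vector field. -/
abbrev cls (Ω : Structure N n P) {k : ℕ} (X : HVF Ω k) : SHVrank Ω k :=
  Submodule.Quotient.mk X

/-- `SHV = ⨁_{p ≥ 1} SHV^p`, indexed by `k = p - 1`. -/
abbrev SHV (Ω : Structure N n P) : Type _ :=
  ⨁ k : ℕ, SHVrank Ω k

/-- The symmetrized Lie bracket of vector-valued vector fields, with components
`[X^{(α₁ … α_k}, Y^{α_{k+1} … α_{k+l})}]`. -/
def symBracket {k l : ℕ} (X : (Fin k → Fin n) → VField N P)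
    (Y : (Fin l → Fin n) → VField N P) : (Fin (k + l) → Fin n) → VField N P :=
  symmetrize fun K : Fin (k + l) → Fin n =>
    lieBr (X (K ∘ Fin.castAdd l)) (Y (K ∘ Fin.natAdd k))

/-- A bilinear map is a Lie bracket: it is alternating and satisfies the Jacobi identity. -/
structure IsLieBracket {L : Type*} [AddCommMonoid L] [Module ℝ L]
    (B : L →ₗ[ℝ] L →ₗ[ℝ] L) : Prop where
  alternating : ∀ x, B x x = 0
  jacobi : ∀ x y z, B x (B y z) + B y (B z x) + B z (B x y) = 0

end NSymplectic

end

noncomputable section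

namespace NSymplectic


/-! ### Symmetric families as homogeneous polynomials -/

section PolyEval

variable {n m : ℕ} {V W : Type*} [AddCommGroup V] [Module ℝ V] [AddCommGroup W] [Module ℝ W]

/-! A symmetric family `T` of rank `m` is the same as the homogeneous polynomial `T_t = ∑ T^{α₁…α_m}
t_{α₁}⋯t_{α_m}` (polarization, `IsSymmetric.ext_polyEval`), and symmetrizing a family does not
change its polynomial. Put `ω_t = t_α ω^α`, a closed 2-form for each fixed `t`. The structure
equation then says that `d f_t = -p! X_t ⌟ ω_t` for all `t`, the kernel equation that `Y_t ⌟ ω_t =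
0`, and the symmetrized bracket of `X` and `Z` has polynomial `[X_t, Z_t]`.

Everything thus reduces to one closed 2-form `η` at a time. If `df = X ⌟ η` and `dg = Z ⌟ η`, then
`d(X(g)) = [X, Z] ⌟ η` (`differential_dirDeriv`), a local computation from `dη = 0` and the symmetry
of the Hessians of `f` and `g`. This gives closure under the bracket. With `g = 0` it also shows
that bracketing a Hamiltonian field with a kernel field gives a kernel field, so the bracket
descends to classes. Skew symmetry and the Jacobi identity hold for `[X_t, Z_t]` at every `t`, hence
already for representatives, before passing to the quotient. -/

/-- The value `∑ T^{α₁ … α_m} t_{α₁} ⋯ t_{α_m}` at `t` of the homogeneous polynomial defined by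
the family `T`. -/
def polyEval (t : Fin n → ℝ) (T : (Fin m → Fin n) → V) : V :=
  ∑ J, (∏ i, t (J i)) • T J

lemma map_polyEval (L : V →ₗ[ℝ] W) (t : Fin n → ℝ) (T : (Fin m → Fin n) → V) :
    L (polyEval t T) = polyEval t fun J => L (T J) := by
  simp [polyEval]

lemma polyEval_add (t : Fin n → ℝ) (S T : (Fin m → Fin n) → V) :
    polyEval t (S + T) = polyEval t S + polyEval t T := by
  simp [polyEval, Finset.sum_add_distrib]

lemma polyEval_sub (t : Fin n → ℝ) (S T : (Fin m → Fin n) → V) :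
    polyEval t (S - T) = polyEval t S - polyEval t T := by
  simp [polyEval, smul_sub]

lemma polyEval_smul (t : Fin n → ℝ) (c : ℝ) (T : (Fin m → Fin n) → V) :
    polyEval t (c • T) = c • polyEval t T := by
  simp [polyEval, Finset.smul_sum, smul_comm c]

lemma polyEval_comp_perm (t : Fin n → ℝ) (T : (Fin m → Fin n) → V) (σ : Equiv.Perm (Fin m)) :
    polyEval t (fun J => T (J ∘ σ)) = polyEval t T := by
  unfold polyEval
  refine Fintype.sum_equiv (σ.symm.arrowCongr (Equiv.refl _)) _ _ fun J => ?_
  congr 1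
  exact (Equiv.prod_comp σ fun i => t (J i)).symm

/-- Monomials do not see the order of the indices, so the `m!` permuted families all have the same
polynomial and the average leaves it unchanged. -/
lemma polyEval_symmetrize (t : Fin n → ℝ) (T : (Fin m → Fin n) → V) :
    polyEval t (symmetrize T) = polyEval t T := by
  have h : symmetrize T = (m ! : ℝ)⁻¹ • ∑ σ : Equiv.Perm (Fin m), fun J => T (J ∘ σ) := by
    funext J
    simp [symmetrize]
  have hs : polyEval t (∑ σ : Equiv.Perm (Fin m), fun J => T (J ∘ σ))
      = ∑ σ : Equiv.Perm (Fin m), polyEval t fun J => T (J ∘ σ) := by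
    simp only [polyEval, Finset.sum_apply, Finset.smul_sum]
    exact Finset.sum_comm
  rw [h, polyEval_smul, hs]
  simp only [polyEval_comp_perm, Finset.sum_const, Finset.card_univ, Fintype.card_perm,
    Fintype.card_fin]
  rw [← Nat.cast_smul_eq_nsmul ℝ, inv_smul_smul₀ (by positivity)]

lemma isSymmetric_symmetrize (T : (Fin m → Fin n) → V) : IsSymmetric (symmetrize T) := by
  intro σ J
  simp only [symmetrize]
  congr 1
  exact Fintype.sum_equiv (Equiv.mulLeft σ) _ _ fun τ => rfl

lemma IsSymmetric.sub {A : Type*} [AddCommGroup A] {S T : (Fin m → Fin n) → A} (hS : IsSymmetric S) (hT : IsSymmetric T) :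
    IsSymmetric (S - T) := fun σ J => by
  simp [hS σ J, hT σ J]

/-- Equal exponent vectors mean that `J` and `K` take each value equally often; bijections between
corresponding fibres glue to a permutation. -/
lemma exists_perm_of_sum_single_eq {J K : Fin m → Fin n}
    (h : ∑ i, Finsupp.single (J i) 1 = (∑ i, Finsupp.single (K i) 1 : Fin n →₀ ℕ)) :
    ∃ σ : Equiv.Perm (Fin m), K ∘ σ = J := by
  have hc (c : Fin n) : Nonempty ({a // J a = c} ≃ {a // K a = c}) := by
    refine ⟨Fintype.equivOfCardEq ?_⟩
    have := DFunLike.congr_fun h c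
    simpa [Finsupp.finsetSum_apply, Finsupp.single_apply, Fintype.card_subtype] using this
  exact ⟨Equiv.ofFiberEquiv fun c => (hc c).some, funext fun a => Equiv.ofFiberEquiv_map _ a⟩

/-- A real polynomial that vanishes at every point is zero. By symmetry its coefficient at the
exponent of `K` is `T K` times the number of rearrangements of `K`, which is positive. -/
lemma IsSymmetric.eq_zero_of_polyEval_real {T : (Fin m → Fin n) → ℝ} (hT : IsSymmetric T)
    (h : ∀ t, polyEval t T = 0) : T = 0 := by
  classical
  let p : MvPolynomial (Fin n) ℝ :=
    ∑ J, MvPolynomial.monomial (∑ i, Finsupp.single (J i) 1) (T J)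
  have hp : p = 0 := by
    refine MvPolynomial.funext fun t => ?_
    rw [map_zero, ← h t]
    simp only [p, polyEval, map_sum, smul_eq_mul]
    refine Finset.sum_congr rfl fun J _ => ?_
    rw [MvPolynomial.eval_monomial, mul_comm]
    congr 1
    rw [Finsupp.prod_pow]
    simp only [Finsupp.finsetSum_apply, ← Finset.prod_pow_eq_pow_sum]
    rw [Finset.prod_comm]
    refine Finset.prod_congr rfl fun i _ => ?_
    simp [Finsupp.single_apply, pow_ite]
  funext K
  have hK := congrArg (MvPolynomial.coeff (∑ i, Finsupp.single (K i) 1)) hp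
  simp only [p, MvPolynomial.coeff_sum, MvPolynomial.coeff_monomial,
    MvPolynomial.coeff_zero] at hK
  have hsum : ∑ J : Fin m → Fin n, (if ∑ i, Finsupp.single (J i) 1 =
      (∑ i, Finsupp.single (K i) 1 : Fin n →₀ ℕ) then T J else 0) =
      ∑ J : Fin m → Fin n, if ∑ i, Finsupp.single (J i) 1 =
      (∑ i, Finsupp.single (K i) 1 : Fin n →₀ ℕ) then T K else 0 := by
    refine Finset.sum_congr rfl fun J _ => ?_
    split_ifs with hJ
    · obtain ⟨σ, rfl⟩ := exists_perm_of_sum_single_eq hJ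
      exact hT σ K
    · rfl
  rw [hsum, ← Finset.sum_filter, Finset.sum_const, smul_eq_zero] at hK
  refine hK.resolve_left fun h0 => ?_
  rw [Finset.card_eq_zero] at h0
  exact Finset.notMem_empty K (h0 ▸ Finset.mem_filter.2 ⟨Finset.mem_univ K, rfl⟩)

/-- Polarization: a symmetric family is determined by the polynomial it defines. -/
lemma IsSymmetric.ext_polyEval {S T : (Fin m → Fin n) → V} (hS : IsSymmetric S)
    (hT : IsSymmetric T) (h : ∀ t, polyEval t S = polyEval t T) : S = T := by
  rw [← sub_eq_zero]
  funext J
  -- Linear functionals separate the points of a real vector space, which reduces to scalar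
  -- coefficients.
  refine (Module.forall_dual_apply_eq_zero_iff ℝ _).1 fun L => ?_
  have hL : IsSymmetric fun J => L ((S - T) J) := fun σ J => congrArg L (hS.sub hT σ J)
  refine congrFun (hL.eq_zero_of_polyEval_real fun t => ?_) J
  rw [← map_polyEval, polyEval_sub, h t, sub_self, map_zero]

/-- The polynomial of a product of families is the product of the polynomials. -/
lemma polyEval_append {U : Type*} [AddCommGroup U] [Module ℝ U] {k l : ℕ}
    (b : V →ₗ[ℝ] W →ₗ[ℝ] U) (t : Fin n → ℝ) (S : (Fin k → Fin n) → V)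
    (T : (Fin l → Fin n) → W) :
    polyEval t (fun K : Fin (k + l) → Fin n => b (S (K ∘ Fin.castAdd l)) (T (K ∘ Fin.natAdd k)))
      = b (polyEval t S) (polyEval t T) := by
  have hb : b (polyEval t S) (polyEval t T) =
      ∑ A, ∑ B, ((∏ i, t (A i)) * ∏ i, t (B i)) • b (S A) (T B) := by
    simp only [polyEval, map_sum, map_smul, LinearMap.sum_apply, LinearMap.smul_apply,
      Finset.smul_sum, smul_smul]
    rw [Finset.sum_comm]
    simp only [mul_comm]
  rw [hb, ← Fintype.sum_prod_type']
  refine (Fintype.sum_equiv (Fin.appendEquiv k l) _ _ fun p => ?_).symm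
  have h₁ : Fin.append p.1 p.2 ∘ Fin.castAdd l = p.1 := funext fun i => Fin.append_left _ _ i
  have h₂ : Fin.append p.1 p.2 ∘ Fin.natAdd k = p.2 := funext fun i => Fin.append_right _ _ i
  simp [Fin.appendEquiv, h₁, h₂, Fin.prod_univ_add]

/-- Splitting off the last index. -/
lemma polyEval_snoc {U : Type*} [AddCommGroup U] [Module ℝ U] {k : ℕ}
    (b : V →ₗ[ℝ] W →ₗ[ℝ] U) (t : Fin n → ℝ) (S : (Fin k → Fin n) → V) (T : Fin n → W) :
    polyEval t (fun K : Fin (k + 1) → Fin n => b (S (Fin.init K)) (T (K (Fin.last k))))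
      = b (polyEval t S) (∑ α, t α • T α) := by
  have hb : b (polyEval t S) (∑ α, t α • T α) =
      ∑ α, ∑ A, ((∏ i, t (A i)) * t α) • b (S A) (T α) := by
    simp only [polyEval, map_sum, map_smul, LinearMap.sum_apply, LinearMap.smul_apply,
      Finset.smul_sum, smul_smul]
    simp only [mul_comm]
  rw [hb, ← Fintype.sum_prod_type']
  refine (Fintype.sum_equiv (Fin.snocEquiv fun _ => Fin n) _ _ fun p => ?_).symm
  simp [Fin.snocEquiv, Fin.prod_univ_castSucc]

end PolyEval


/-! ### Hamiltonian vector fields on an open piece of a presymplectic vector space -/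

section Local

variable {E : Type*} [NormedAddCommGroup E] [NormedSpace ℝ E]

lemma alternating_two_swap (η : E [⋀^Fin 2]→L[ℝ] ℝ) (v w : E) : η ![v, w] = -η ![w, v] := by
  have h : η (![w, v] ∘ Equiv.swap 0 1) = -η ![w, v] := η.map_swap ![w, v] (by simp)
  rw [← h]
  congr 1
  funext i
  fin_cases i <;> simp

lemma fderiv_alternating_two_apply {η : E → E [⋀^Fin 2]→L[ℝ] ℝ} {X Z : E → E} {y : E}
    (hη : DifferentiableAt ℝ η y) (hX : DifferentiableAt ℝ X y) (hZ : DifferentiableAt ℝ Z y)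
    (v : E) :
    fderiv ℝ (fun y' => η y' ![X y', Z y']) y v =
      fderiv ℝ η y v ![X y, Z y] + η y ![fderiv ℝ X y v, Z y] + η y ![X y, fderiv ℝ Z y v] := by
  have hXZ : ∀ i, DifferentiableAt ℝ (![X, Z] i) y := by
    intro i
    fin_cases i
    · exact hX
    · exact hZ
  have hvec (y' : E) : (fun i => ![X, Z] i y') = ![X y', Z y'] := by
    funext i
    fin_cases i <;> rfl
  have h := fderiv_continuousAlternatingMap_apply_apply hη hXZ v
  simp only [hvec, Fin.sum_univ_two] at h
  rw [h, add_assoc]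
  congr 3
  · funext i
    fin_cases i <;> rfl
  · funext i
    fin_cases i <;> rfl

/-- Differentiating `df = X ⌟ η` once more expresses the Hessian of `f` by first derivatives of `η`
and `X`; its symmetry is the local form of `d(X ⌟ η) = 0`. -/
lemma fderiv_fderiv_of_hamiltonian {η : E → E [⋀^Fin 2]→L[ℝ] ℝ} {X : E → E} {f : E → ℝ} {y : E}
    (hη : DifferentiableAt ℝ η y) (hX : DifferentiableAt ℝ X y) (hf : ContDiffAt ℝ 2 f y)
    (hfX : ∀ᶠ y' in nhds y, ∀ v, fderiv ℝ f y' v = η y' ![X y', v]) (u v : E) :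
    fderiv ℝ (fderiv ℝ f) y u v = fderiv ℝ η y u ![X y, v] + η y ![fderiv ℝ X y u, v] := by
  have h₁ : DifferentiableAt ℝ (fderiv ℝ f) y :=
    (hf.fderiv_right (m := 1) (by norm_num)).differentiableAt (by simp)
  have h₂ : fderiv ℝ (fun y' => fderiv ℝ f y' v) y u = fderiv ℝ (fderiv ℝ f) y u v := by
    rw [fderiv_clm_apply h₁ (differentiableAt_const v)]
    simp
  have h₃ : (fun y' => fderiv ℝ f y' v) =ᶠ[nhds y] fun y' => η y' ![X y', v] :=
    hfX.mono fun y' h => h v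
  rw [← h₂, h₃.fderiv_eq, fderiv_alternating_two_apply hη hX (differentiableAt_const v)]
  have : η y ![X y, (0 : E)] = 0 := (η y).map_coord_zero 1 rfl
  simp [this]

/-- The bracket of the Hamiltonian vector fields `X`, `Z` of a closed 2-form `η` is Hamiltonian,
with Hamiltonian function `-η(X, Z)`. -/
lemma fderiv_apply_hamiltonian_pair {η : E → E [⋀^Fin 2]→L[ℝ] ℝ} {X Z : E → E} {f g : E → ℝ}
    {y : E} (hη : DifferentiableAt ℝ η y) (hX : DifferentiableAt ℝ X y)
    (hZ : DifferentiableAt ℝ Z y) (hf : ContDiffAt ℝ 2 f y) (hg : ContDiffAt ℝ 2 g y)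
    (hfX : ∀ᶠ y' in nhds y, ∀ v, fderiv ℝ f y' v = η y' ![X y', v])
    (hgZ : ∀ᶠ y' in nhds y, ∀ v, fderiv ℝ g y' v = η y' ![Z y', v])
    (hclosed : extDeriv η y = 0) (v : E) :
    fderiv ℝ (fun y' => η y' ![X y', Z y']) y v = -η y ![lieBracket ℝ X Z y, v] := by
  -- This is `dη(X, Z, v) = 0`, written as an alternating sum of derivatives of `η` with `X`, `Z`,
  -- `v` frozen at `y`.
  have hd : ∑ i : Fin 3, (-1) ^ (i : ℕ) •
      fderiv ℝ η y (![X y, Z y, v] i) (i.removeNth ![X y, Z y, v]) = 0 := by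
    rw [← ContinuousAlternatingMap.alternatizeUncurryFin_apply]
    exact DFunLike.congr_fun hclosed ![X y, Z y, v]
  have e₀ : Fin.removeNth 0 ![X y, Z y, v] = ![Z y, v] := by
    funext i; fin_cases i <;> rfl
  have e₁ : Fin.removeNth 1 ![X y, Z y, v] = ![X y, v] := by
    funext i; fin_cases i <;> rfl
  have e₂ : Fin.removeNth 2 ![X y, Z y, v] = ![X y, Z y] := by
    funext i; fin_cases i <;> rfl
  simp [Fin.sum_univ_three, e₀, e₁, e₂] at hd
  -- The two Hessian symmetries trade the derivatives of `X` and `Z` along `v` for `DX(Z)` and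
  -- `DZ(X)`, the two terms of the bracket. The derivatives of `η` left over add up to `-dη(X, Z,
  -- v)`.
  have hsf := hf.isSymmSndFDerivAt (by simp) (Z y) v
  have hsg := hg.isSymmSndFDerivAt (by simp) (X y) v
  rw [fderiv_fderiv_of_hamiltonian hη hX hf hfX, fderiv_fderiv_of_hamiltonian hη hX hf hfX] at hsf
  rw [fderiv_fderiv_of_hamiltonian hη hZ hg hgZ, fderiv_fderiv_of_hamiltonian hη hZ hg hgZ] at hsg
  have hbr : η y ![lieBracket ℝ X Z y, v] =
      η y ![fderiv ℝ Z y (X y), v] - η y ![fderiv ℝ X y (Z y), v] := by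
    rw [eq_sub_iff_add_eq]
    refine ((η y).toAlternatingMap.map_vecCons_add ![v] _ _).symm.trans ?_
    rw [lieBracket, sub_add_cancel]
    rfl
  rw [fderiv_alternating_two_apply hη hX hZ, hbr]
  have s₁ := alternating_two_swap (fderiv ℝ η y v) (X y) (Z y)
  have s₂ := alternating_two_swap (η y) (fderiv ℝ Z y v) (X y)
  linarith

end Local


section Manifold

variable {N n : ℕ} {P : Type*} [TopologicalSpace P]
  [ChartedSpace (EuclideanSpace ℝ (Fin N)) P] [IsManifold (𝓡 N) ∞ P]

/-! ### Directional derivatives -/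

lemma mdifferentiableAt_vField (X : VField N P) (x : P) :
    MDifferentiableAt (𝓡 N) (𝓡 N).tangent
      (fun x => (⟨x, X x⟩ : TangentBundle (𝓡 N) P)) x :=
  X.contMDiff.mdifferentiableAt (by simp)

/-- The derivative `X(f) = df(X)` of a smooth function along a smooth vector field. -/
def dirDeriv (X : VField N P) (f : C^∞⟮𝓡 N, P; ℝ⟯) : C^∞⟮𝓡 N, P; ℝ⟯ where
  val x := differential f x (X x)
  property := by
    have h₁ : ContMDiff (𝓡 N).tangent 𝓘(ℝ, ℝ).tangent ∞ (tangentMap (𝓡 N) 𝓘(ℝ, ℝ) f) :=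
      f.contMDiff.contMDiff_tangentMap (by simp)
    exact contMDiff_snd_tangentBundle_modelSpace ℝ 𝓘(ℝ, ℝ) |>.comp (h₁.comp X.contMDiff)

lemma dirDeriv_apply (X : VField N P) (f : C^∞⟮𝓡 N, P; ℝ⟯) (x : P) :
    dirDeriv X f x = differential f x (X x) := rfl

/-- `dirDeriv` as a bilinear map. -/
def dirDerivₗ : VField N P →ₗ[ℝ] C^∞⟮𝓡 N, P; ℝ⟯ →ₗ[ℝ] C^∞⟮𝓡 N, P; ℝ⟯ :=
  LinearMap.mk₂ ℝ dirDeriv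
    (fun X Y f => by ext x; exact map_add (mfderiv (𝓡 N) 𝓘(ℝ, ℝ) f x) (X x) (Y x))
    (fun c X f => by ext x; exact map_smul (mfderiv (𝓡 N) 𝓘(ℝ, ℝ) f x) c (X x))
    (fun X f g => by ext x; exact differential_add f g x (X x))
    (fun c X f => by ext x; exact differential_smul c f x (X x))

/-- The differential at a tangent vector as a linear form on functions. -/
def differentialₗ (x : P) (v : TangentSpace (𝓡 N) x) : C^∞⟮𝓡 N, P; ℝ⟯ →ₗ[ℝ] ℝ where
  toFun f := differential f x v
  map_add' f g := differential_add f g x v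
  map_smul' c f := differential_smul c f x v

/-! ### The Lie bracket of smooth vector fields -/

lemma lieBr_apply (X Y : VField N P) (x : P) : lieBr X Y x = mlieBracket (𝓡 N) X Y x := rfl

lemma lieBr_swap (X Y : VField N P) : lieBr X Y = -lieBr Y X := by
  ext1 x
  exact mlieBracket_swap_apply

lemma lieBr_add_left (X Y Z : VField N P) : lieBr (X + Y) Z = lieBr X Z + lieBr Y Z := by
  ext1 x
  exact mlieBracket_add_left (mdifferentiableAt_vField X x) (mdifferentiableAt_vField Y x)

lemma lieBr_smul_left (c : ℝ) (X Z : VField N P) : lieBr (c • X) Z = c • lieBr X Z := by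
  ext1 x
  exact mlieBracket_const_smul_left (mdifferentiableAt_vField X x)

/-- The Lie bracket of smooth vector fields as a bilinear map. -/
def lieBrₗ : VField N P →ₗ[ℝ] VField N P →ₗ[ℝ] VField N P :=
  LinearMap.mk₂ ℝ lieBr lieBr_add_left lieBr_smul_left
    (fun X Y Z => by rw [lieBr_swap, lieBr_add_left, neg_add, ← lieBr_swap, ← lieBr_swap])
    (fun c X Z => by rw [lieBr_swap, lieBr_smul_left, ← smul_neg, ← lieBr_swap])

lemma lieBr_jacobi (X Y Z : VField N P) :
    lieBr X (lieBr Y Z) + lieBr Y (lieBr Z X) + lieBr Z (lieBr X Y) = 0 := by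
  have : IsManifold (𝓡 N) (minSmoothness ℝ 3) P :=
    IsManifold.of_le (n := ∞) (by simpa using ENat.LEInfty.out)
  have h (W : VField N P) : ContMDiff (𝓡 N) (𝓡 N).tangent (minSmoothness ℝ 2)
      (fun x => (⟨x, W x⟩ : TangentBundle (𝓡 N) P)) :=
    W.contMDiff.of_le (by simpa using ENat.LEInfty.out)
  have hL : lieBr X (lieBr Y Z) = lieBr (lieBr X Y) Z + lieBr Y (lieBr X Z) := by
    ext1 x
    exact leibniz_identity_mlieBracket_apply (h X x) (h Y x) (h Z x)
  have h₁ : lieBr Y (lieBr Z X) = -lieBr Y (lieBr X Z) := by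
    rw [lieBr_swap Z X]
    exact map_neg (lieBrₗ Y) _
  rw [hL, h₁, lieBr_swap Z]
  abel

/-! ### Representatives in a chart -/

/-- The local representative of a vector field in the chart around `x₀`. -/
def chartField (X : VField N P) (x₀ : P) (y : EuclideanSpace ℝ (Fin N)) :
    EuclideanSpace ℝ (Fin N) :=
  mpullbackWithin 𝓘(ℝ, EuclideanSpace ℝ (Fin N)) (𝓡 N) (extChartAt (𝓡 N) x₀).symm X
    (Set.range (𝓡 N)) y

/-- The derivative of the inverse of the chart around `x₀`. -/
def chartSymmDeriv (x₀ : P) (y : EuclideanSpace ℝ (Fin N)) :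
    EuclideanSpace ℝ (Fin N) →L[ℝ] TangentSpace (𝓡 N) ((extChartAt (𝓡 N) x₀).symm y) :=
  mfderiv 𝓘(ℝ, EuclideanSpace ℝ (Fin N)) (𝓡 N) (extChartAt (𝓡 N) x₀).symm y

lemma isInvertible_chartSymmDeriv {x₀ : P} {y : EuclideanSpace ℝ (Fin N)}
    (hy : y ∈ (extChartAt (𝓡 N) x₀).target) : (chartSymmDeriv x₀ y).IsInvertible := by
  have := isInvertible_mfderivWithin_extChartAt_symm (I := 𝓡 N) hy
  rw [ModelWithCorners.range_eq_univ, mfderivWithin_univ] at this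
  exact this

lemma chartSymmDeriv_chartField (X : VField N P) {x₀ : P} {y : EuclideanSpace ℝ (Fin N)}
    (hy : y ∈ (extChartAt (𝓡 N) x₀).target) :
    chartSymmDeriv x₀ y (chartField X x₀ y) = X ((extChartAt (𝓡 N) x₀).symm y) := by
  have h : chartField X x₀ y =
      (chartSymmDeriv x₀ y).inverse (X ((extChartAt (𝓡 N) x₀).symm y)) := by
    rw [chartField, mpullbackWithin_apply, ModelWithCorners.range_eq_univ, mfderivWithin_univ]
    rfl
  rw [h]
  exact (isInvertible_chartSymmDeriv hy).self_apply_inverse _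

lemma differentiableAt_chartField (X : VField N P) (x₀ : P) :
    DifferentiableAt ℝ (chartField X x₀) (extChartAt (𝓡 N) x₀ x₀) := by
  have h := (mdifferentiableAt_vField X x₀).mdifferentiableWithinAt
    (s := Set.univ) |>.differentiableWithinAt_mpullbackWithin_vectorField
  rw [Set.preimage_univ, Set.univ_inter, ModelWithCorners.range_eq_univ] at h
  rw [← differentiableWithinAt_univ]
  unfold chartField
  rw [ModelWithCorners.range_eq_univ]
  exact h

/-- The bracket on the manifold is by construction the bracket in the chart, pulled back by the
derivative of the chart; the derivative of the inverse chart undoes that pullback. -/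
lemma chartSymmDeriv_lieBracket (X Z : VField N P) (x₀ : P) :
    chartSymmDeriv x₀ (extChartAt (𝓡 N) x₀ x₀)
      (lieBracket ℝ (chartField X x₀) (chartField Z x₀) (extChartAt (𝓡 N) x₀ x₀)) =
    lieBr X Z ((extChartAt (𝓡 N) x₀).symm (extChartAt (𝓡 N) x₀ x₀)) := by
  set u : EuclideanSpace ℝ (Fin N) :=
    lieBracket ℝ (chartField X x₀) (chartField Z x₀) (extChartAt (𝓡 N) x₀ x₀) with hu₀
  have hx : (extChartAt (𝓡 N) x₀).symm (extChartAt (𝓡 N) x₀ x₀) = x₀ := extChartAt_to_inv x₀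
  -- All tangent spaces are copies of the model space, so the base point can be changed by viewing
  -- the values there.
  have hbr : (lieBr X Z ((extChartAt (𝓡 N) x₀).symm (extChartAt (𝓡 N) x₀ x₀)) :
      EuclideanSpace ℝ (Fin N)) = lieBr X Z x₀ :=
    congrArg (fun x => (lieBr X Z x : EuclideanSpace ℝ (Fin N))) hx
  refine Eq.trans ?_ hbr.symm
  have hz : lieBr X Z x₀ = (mfderiv (𝓡 N) 𝓘(ℝ, EuclideanSpace ℝ (Fin N))
      (extChartAt (𝓡 N) x₀) x₀).inverse
        u := by
    rw [hu₀, lieBr_apply, ← mlieBracketWithin_univ, mlieBracketWithin_apply, Set.preimage_univ,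
      Set.univ_inter, ← lieBracketWithin_univ]
    congr 2
    exact ModelWithCorners.range_eq_univ _
  have hid := mfderivWithin_extChartAt_symm_comp_mfderiv_extChartAt' (I := 𝓡 N)
    (mem_extChartAt_source (I := 𝓡 N) x₀)
  rw [ModelWithCorners.range_eq_univ, mfderivWithin_univ] at hid
  have hu := (isInvertible_mfderiv_extChartAt (I := 𝓡 N)
    (mem_extChartAt_source (I := 𝓡 N) x₀)).self_apply_inverse
      u
  rw [← hz] at hu
  exact (congrArg (chartSymmDeriv x₀ (extChartAt (𝓡 N) x₀ x₀)) hu).symm.trans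
    (DFunLike.congr_fun hid (lieBr X Z x₀))

omit [IsManifold (𝓡 N) ∞ P] in
lemma chartForm_apply (Ω : TwoForm N P) (x₀ : P) (y v w : EuclideanSpace ℝ (Fin N)) :
    chartForm Ω x₀ y ![v, w] =
      Ω ((extChartAt (𝓡 N) x₀).symm y) ![chartSymmDeriv x₀ y v, chartSymmDeriv x₀ y w] := by
  refine congrArg (Ω ((extChartAt (𝓡 N) x₀).symm y)) ?_
  funext i
  fin_cases i <;> rfl

lemma contDiffOn_comp_extChartAt_symm (f : C^∞⟮𝓡 N, P; ℝ⟯) (x₀ : P) :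
    ContDiffOn ℝ ∞ (f ∘ (extChartAt (𝓡 N) x₀).symm) (extChartAt (𝓡 N) x₀).target := by
  rw [← contMDiffOn_iff_contDiffOn]
  exact f.contMDiff.comp_contMDiffOn (contMDiffOn_extChartAt_symm x₀)

lemma fderiv_comp_extChartAt_symm (f : C^∞⟮𝓡 N, P; ℝ⟯) {x₀ : P}
    {y : EuclideanSpace ℝ (Fin N)} (hy : y ∈ (extChartAt (𝓡 N) x₀).target)
    (v : EuclideanSpace ℝ (Fin N)) :
    fderiv ℝ (f ∘ (extChartAt (𝓡 N) x₀).symm) y v =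
      differential f ((extChartAt (𝓡 N) x₀).symm y) (chartSymmDeriv x₀ y v) := by
  have h₁ : MDifferentiableAt 𝓘(ℝ, EuclideanSpace ℝ (Fin N)) (𝓡 N)
      (extChartAt (𝓡 N) x₀).symm y :=
    ((contMDiffOn_extChartAt_symm (n := ∞) x₀).contMDiffAt
      ((isOpen_extChartAt_target x₀).mem_nhds hy)).mdifferentiableAt (by simp)
  have h₂ : MDifferentiableAt (𝓡 N) 𝓘(ℝ, ℝ) f ((extChartAt (𝓡 N) x₀).symm y) :=
    f.contMDiff.mdifferentiableAt (by simp)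
  rw [← mfderiv_eq_fderiv, mfderiv_comp y h₂ h₁]
  rfl

/-- If `X` and `Z` are Hamiltonian vector fields of a closed 2-form, with Hamiltonian functions
`f` and `g`, then `[X, Z]` is Hamiltonian, with Hamiltonian function `X(g)`. -/
lemma differential_dirDeriv {Ω : TwoForm N P} (hs : Ω.IsSmooth) (hcl : Ω.IsClosed)
    {X Z : VField N P} {f g : C^∞⟮𝓡 N, P; ℝ⟯}
    (hf : ∀ x v, differential f x v = Ω x ![X x, v])
    (hg : ∀ x v, differential g x v = Ω x ![Z x, v])
    (x₀ : P) (v : TangentSpace (𝓡 N) x₀) :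
    differential (dirDeriv X g) x₀ v = Ω x₀ ![lieBr X Z x₀, v] := by
  set c := extChartAt (𝓡 N) x₀
  have hy₀ : c x₀ ∈ c.target := mem_extChartAt_target x₀
  have hn : c.target ∈ nhds (c x₀) := (isOpen_extChartAt_target x₀).mem_nhds hy₀
  -- Generalizing the base point turns it into `c.symm (c x₀)` itself, so that no transport between
  -- tangent spaces is needed.
  suffices h : ∀ x, x = c.symm (c x₀) → ∀ v : TangentSpace (𝓡 N) x,
      differential (dirDeriv X g) x v = Ω x ![lieBr X Z x, v] from
    h x₀ (extChartAt_to_inv x₀).symm v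
  rintro x rfl v
  obtain ⟨w, rfl⟩ : ∃ w, chartSymmDeriv x₀ (c x₀) w = v :=
    ⟨_, (isInvertible_chartSymmDeriv hy₀).self_apply_inverse v⟩
  have ham {h : C^∞⟮𝓡 N, P; ℝ⟯} {W : VField N P}
      (hh : ∀ x v, differential h x v = Ω x ![W x, v]) :
      ∀ᶠ y in nhds (c x₀), ∀ u, fderiv ℝ (h ∘ c.symm) y u =
        chartForm Ω x₀ y ![chartField W x₀ y, u] := by
    filter_upwards [hn] with y hy u
    rw [fderiv_comp_extChartAt_symm h hy, hh, chartForm_apply, chartSymmDeriv_chartField W hy]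
  have hsm (h : C^∞⟮𝓡 N, P; ℝ⟯) : ContDiffAt ℝ 2 (h ∘ c.symm) (c x₀) :=
    ((contDiffOn_comp_extChartAt_symm h x₀).contDiffAt hn).of_le ENat.LEInfty.out
  have hΩ : DifferentiableAt ℝ (chartForm Ω x₀) (c x₀) :=
    ((hs x₀).contDiffAt hn).differentiableAt (by simp)
  -- The order is `Z`, `X` because `X(g) = dg(X) = Ω(Z, X)`; the sign from swapping the bracket then
  -- cancels the one in the local formula.
  have key := fderiv_apply_hamiltonian_pair hΩ (differentiableAt_chartField Z x₀)
    (differentiableAt_chartField X x₀) (hsm g) (hsm f) (ham hg) (ham hf) (hcl x₀ _ hy₀) w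
  have heq : (dirDeriv X g ∘ c.symm) =ᶠ[nhds (c x₀)]
      fun y => chartForm Ω x₀ y ![chartField Z x₀ y, chartField X x₀ y] := by
    filter_upwards [hn] with y hy
    rw [Function.comp_apply, dirDeriv_apply, hg, chartForm_apply, chartSymmDeriv_chartField X hy,
      chartSymmDeriv_chartField Z hy]
  rw [← fderiv_comp_extChartAt_symm _ hy₀, heq.fderiv_eq, key, chartForm_apply,
    chartSymmDeriv_lieBracket, lieBr_swap X Z]
  have := (Ω (c.symm (c x₀))).toAlternatingMap.map_vecCons_smul
    ![chartSymmDeriv x₀ (c x₀) w] (-1) (lieBr Z X (c.symm (c x₀)))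
  simp only [neg_smul, one_smul] at this
  exact this.symm

end Manifold


section Bracket

variable {N n : ℕ} {P : Type*} [TopologicalSpace P]
  [ChartedSpace (EuclideanSpace ℝ (Fin N)) P]

/-! ### The closed 2-forms `t_α ω^α` -/

lemma chartForm_zero (x₀ : P) : chartForm (0 : TwoForm N P) x₀ = 0 := rfl

lemma chartForm_add (Ω Ω' : TwoForm N P) (x₀ : P) :
    chartForm (Ω + Ω') x₀ = chartForm Ω x₀ + chartForm Ω' x₀ := rfl

lemma chartForm_smul (c : ℝ) (Ω : TwoForm N P) (x₀ : P) :
    chartForm (c • Ω) x₀ = c • chartForm Ω x₀ := rfl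

/-- Smooth closed 2-forms. -/
def closedForms (N : ℕ) (P : Type*) [TopologicalSpace P]
    [ChartedSpace (EuclideanSpace ℝ (Fin N)) P] : Submodule ℝ (TwoForm N P) where
  carrier := {Ω | Ω.IsSmooth ∧ Ω.IsClosed}
  zero_mem' := by
    refine ⟨fun x₀ => ?_, fun x₀ y hy => ?_⟩
    · rw [chartForm_zero]
      exact contDiffOn_const
    · rw [chartForm_zero]
      simpa using extDeriv_smul (0 : ℝ) (chartForm (0 : TwoForm N P) x₀) (x := y)
  add_mem' := by
    rintro Ω Ω' ⟨hs, hc⟩ ⟨hs', hc'⟩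
    refine ⟨fun x₀ => (hs x₀).add (hs' x₀), fun x₀ y hy => ?_⟩
    have hn := (isOpen_extChartAt_target (I := 𝓡 N) x₀).mem_nhds hy
    rw [chartForm_add, extDeriv_add (((hs x₀).contDiffAt hn).differentiableAt (by simp))
      (((hs' x₀).contDiffAt hn).differentiableAt (by simp)), hc x₀ y hy, hc' x₀ y hy, add_zero]
  smul_mem' := by
    rintro c Ω ⟨hs, hc⟩
    refine ⟨fun x₀ => (hs x₀).const_smul c, fun x₀ y hy => ?_⟩
    rw [chartForm_smul, extDeriv_smul, hc x₀ y hy, smul_zero]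

/-- The 2-form `t_α ω^α`. -/
def polyForm (Ω : Structure N n P) (t : Fin n → ℝ) : TwoForm N P :=
  ∑ α, t α • Ω.form α

lemma polyForm_mem_closedForms (Ω : Structure N n P) (t : Fin n → ℝ) :
    polyForm Ω t ∈ closedForms N P :=
  Submodule.sum_mem _ fun α _ => Submodule.smul_mem _ _ ⟨Ω.smooth α, Ω.closed α⟩

variable [IsManifold (𝓡 N) ∞ P]

/-- The interior product `(X ⌟ Ω)(v)` at a point, as a bilinear map in `X` and `Ω`. -/
def contractₗ (x : P) (v : TangentSpace (𝓡 N) x) :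
    VField N P →ₗ[ℝ] TwoForm N P →ₗ[ℝ] ℝ :=
  LinearMap.mk₂ ℝ (fun X Ω => Ω x ![X x, v])
    (fun X Y Ω => (Ω x).toAlternatingMap.map_vecCons_add ![v] (X x) (Y x))
    (fun c X Ω => (Ω x).toAlternatingMap.map_vecCons_smul ![v] c (X x))
    (fun _ _ _ => rfl) (fun _ _ _ => rfl)

/-! ### The structure and kernel equations in polynomial form -/

lemma polyEval_symContract (Ω : Structure N n P) {k : ℕ} (X : (Fin k → Fin n) → VField N P)
    (t : Fin n → ℝ) (x : P) (v : TangentSpace (𝓡 N) x) :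
    polyEval t (fun J => symContract Ω X J x v) = polyForm Ω t x ![polyEval t X x, v] := by
  refine (polyEval_symmetrize t _).trans ?_
  exact polyEval_snoc (contractₗ x v) t X Ω.form

/-- Both sides of the structure equation are symmetric in the indices, the left one by `hf` and the
right one by symmetrization, so polarization applies. -/
lemma structureEq_iff (Ω : Structure N n P) {k : ℕ}
    {f : (Fin (k + 1) → Fin n) → C^∞⟮𝓡 N, P; ℝ⟯} (hf : IsSymmetric f)
    (X : (Fin k → Fin n) → VField N P) :
    StructureEq Ω f X ↔ ∀ t x v, differential (polyEval t f) x v =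
      -((k + 1)! : ℝ) * polyForm Ω t x ![polyEval t X x, v] := by
  have hl (t : Fin n → ℝ) (x : P) (v : TangentSpace (𝓡 N) x) :
      differential (polyEval t f) x v = polyEval t fun J => differential (f J) x v :=
    map_polyEval (differentialₗ x v) t f
  have hr (t : Fin n → ℝ) (x : P) (v : TangentSpace (𝓡 N) x) :
      -((k + 1)! : ℝ) * polyForm Ω t x ![polyEval t X x, v] =
        polyEval t fun J => -((k + 1)! : ℝ) * symContract Ω X J x v := by
    rw [← polyEval_symContract]
    exact (polyEval_smul t _ _).symm
  simp only [hl, hr]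
  refine ⟨fun h t x v => congrArg (polyEval t) (funext fun J => h J x v), fun h J x v => ?_⟩
  refine congrFun (IsSymmetric.ext_polyEval (fun σ J => ?_) (fun σ J => ?_)
    fun t => h t x v) J
  · rw [hf σ J]
  · exact congrArg (-((k + 1)! : ℝ) * ·) (isSymmetric_symmetrize _ σ J)

/-- Polarization is applied to the contraction, which is symmetrized already, so `Y` itself need not
be symmetric. -/
lemma mem_kernelEq_iff (Ω : Structure N n P) {k : ℕ} (Y : (Fin k → Fin n) → VField N P) :
    Y ∈ kernelEq Ω k ↔ ∀ t x v, polyForm Ω t x ![polyEval t Y x, v] = 0 := by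
  simp only [← polyEval_symContract]
  refine ⟨fun h t x v => ?_, fun h J x v => ?_⟩
  · simp only [h _ x v, polyEval, smul_zero, Finset.sum_const_zero]
  · refine congrFun (IsSymmetric.eq_zero_of_polyEval_real ?_ fun t => h t x v) J
    exact isSymmetric_symmetrize _

/-! ### The symmetrized bracket of representatives -/

lemma polyEval_symBracket {k l : ℕ} (X : (Fin k → Fin n) → VField N P)
    (Y : (Fin l → Fin n) → VField N P) (t : Fin n → ℝ) :
    polyEval t (symBracket X Y) = lieBr (polyEval t X) (polyEval t Y) := by
  rw [symBracket, polyEval_symmetrize]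
  exact polyEval_append lieBrₗ t X Y

lemma isSymmetric_symBracket {k l : ℕ} (X : (Fin k → Fin n) → VField N P)
    (Y : (Fin l → Fin n) → VField N P) : IsSymmetric (symBracket X Y) :=
  isSymmetric_symmetrize _

/-- A Hamiltonian vector field of rank `k + 1` defines a Hamiltonian vector field of each of the
closed 2-forms `t_α ω^α`. -/
lemma differential_smul_polyEval {Ω : Structure N n P} {k : ℕ}
    {f : (Fin (k + 1) → Fin n) → C^∞⟮𝓡 N, P; ℝ⟯} {X : (Fin k → Fin n) → VField N P}
    (hf : IsSymmetric f) (h : StructureEq Ω f X) (t : Fin n → ℝ) (x : P)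
    (v : TangentSpace (𝓡 N) x) :
    differential ((-((k + 1)! : ℝ)⁻¹) • polyEval t f) x v =
      polyForm Ω t x ![polyEval t X x, v] := by
  rw [differential_smul, (structureEq_iff Ω hf X).1 h]
  field_simp

lemma symBracket_mem_HVF {Ω : Structure N n P} {k l : ℕ} {X : (Fin k → Fin n) → VField N P}
    {Y : (Fin l → Fin n) → VField N P} (hX : X ∈ HVF Ω k) (hY : Y ∈ HVF Ω l) :
    symBracket X Y ∈ HVF Ω (k + l) := by
  obtain ⟨-, f, hf, hfX⟩ := hX
  obtain ⟨-, g, hg, hgY⟩ := hY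
  -- The length `k + (l + 1)` lets the indices split between `X` and `g`; it is definitionally `(k +
  -- l) + 1`, the length required for the new Hamiltonian function.
  let h₀ : (Fin (k + (l + 1)) → Fin n) → C^∞⟮𝓡 N, P; ℝ⟯ := fun K =>
    dirDerivₗ (X (K ∘ Fin.castAdd (l + 1))) (g (K ∘ Fin.natAdd k))
  let h : (Fin (k + (l + 1)) → Fin n) → C^∞⟮𝓡 N, P; ℝ⟯ :=
    -- The function `-g_t / (l+1)!` is Hamiltonian for `Y_t` with respect to `ω_t`, and the new
    -- structure equation carries the factor `-(k+l+1)!`; the signs cancel.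
    (((k + l + 1)! : ℝ) * ((l + 1)! : ℝ)⁻¹) • symmetrize h₀
  have hh : IsSymmetric h := fun σ J =>
    congrArg (((k + l + 1)! * ((l + 1)! : ℝ)⁻¹ : ℝ) • ·) (isSymmetric_symmetrize h₀ σ J)
  refine ⟨isSymmetric_symBracket X Y, h, hh, ?_⟩
  refine (structureEq_iff Ω (k := k + l) hh _).2 fun t x v => ?_
  obtain ⟨hs, hc⟩ := polyForm_mem_closedForms Ω t
  have key := differential_dirDeriv hs hc (differential_smul_polyEval hf hfX t)
    (differential_smul_polyEval hg hgY t) x v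
  have hp : polyEval t h = -((k + l + 1)! : ℝ) •
      dirDeriv (polyEval t X) ((-((l + 1)! : ℝ)⁻¹) • polyEval t g) := by
    have h₁ := polyEval_append dirDerivₗ t X g
    have h₂ : dirDeriv (polyEval t X) ((-((l + 1)! : ℝ)⁻¹) • polyEval t g) =
        (-((l + 1)! : ℝ)⁻¹) • dirDerivₗ (polyEval t X) (polyEval t g) :=
      map_smul (dirDerivₗ (polyEval t X)) _ _
    rw [h₂, ← h₁, smul_smul, neg_mul_neg, polyEval_smul, polyEval_symmetrize]
  refine (congrArg (fun F => differential F x v) hp).trans ?_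
  rw [differential_smul, key, polyEval_symBracket]

/-- Each `Y_t` is Hamiltonian for `ω_t` with function `0`, so `[X_t, Y_t]` has Hamiltonian function
`X_t(0) = 0`. -/
lemma symBracket_mem_kernelEq_right {Ω : Structure N n P} {k l : ℕ}
    {X : (Fin k → Fin n) → VField N P} {Y : (Fin l → Fin n) → VField N P} (hX : X ∈ HVF Ω k)
    (hY : Y ∈ kernelEq Ω l) : symBracket X Y ∈ kernelEq Ω (k + l) := by
  obtain ⟨-, f, hf, hfX⟩ := hX
  refine (mem_kernelEq_iff Ω _).2 fun t x v => ?_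
  obtain ⟨hs, hc⟩ := polyForm_mem_closedForms Ω t
  have h₀ (W : VField N P) : dirDeriv W 0 = 0 := map_zero (dirDerivₗ W)
  have hz (x : P) (v : TangentSpace (𝓡 N) x) : differential 0 x v = 0 :=
    map_zero (differentialₗ x v)
  have key := differential_dirDeriv hs hc (differential_smul_polyEval hf hfX t) (g := 0)
    (fun x v => (hz x v).trans ((mem_kernelEq_iff Ω Y).1 hY t x v).symm) x v
  rw [polyEval_symBracket, ← key, h₀, hz]

lemma symBracket_mem_kernelEq_left {Ω : Structure N n P} {k l : ℕ}
    {X : (Fin k → Fin n) → VField N P} {Y : (Fin l → Fin n) → VField N P}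
    (hX : X ∈ kernelEq Ω k) (hY : Y ∈ HVF Ω l) : symBracket X Y ∈ kernelEq Ω (k + l) := by
  have h := (mem_kernelEq_iff Ω _).1 (symBracket_mem_kernelEq_right hY hX)
  refine (mem_kernelEq_iff Ω _).2 fun t x v => ?_
  have ht := h t x v
  rw [polyEval_symBracket] at ht ⊢
  rw [lieBr_swap]
  refine (map_neg ((contractₗ x v).flip (polyForm Ω t)) _).trans ?_
  exact neg_eq_zero.2 ht

/-! ### The bracket on equivalence classes -/

/-- The symmetrized bracket of Hamiltonian vector fields, as a bilinear map. -/
def hvfBracket (Ω : Structure N n P) (k l : ℕ) : HVF Ω k →ₗ[ℝ] HVF Ω l →ₗ[ℝ] HVF Ω (k + l) :=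
  LinearMap.mk₂ ℝ (fun X Y => ⟨symBracket X.1 Y.1, symBracket_mem_HVF X.2 Y.2⟩)
    -- Linearity in each argument is checked on polynomials, where it is linearity of the ordinary
    -- Lie bracket.
    (fun X X' Y => Subtype.ext <| (isSymmetric_symBracket _ _).ext_polyEval
      ((HVF Ω (k + l)).add_mem (symBracket_mem_HVF X.2 Y.2) (symBracket_mem_HVF X'.2 Y.2)).1
      fun t => by
        simp only [Submodule.coe_add, polyEval_add, polyEval_symBracket]
        exact lieBr_add_left _ _ _)
    (fun c X Y => Subtype.ext <| (isSymmetric_symBracket _ _).ext_polyEval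
      ((HVF Ω (k + l)).smul_mem c (symBracket_mem_HVF X.2 Y.2)).1
      fun t => by
        simp only [Submodule.coe_smul, polyEval_smul, polyEval_symBracket]
        exact lieBr_smul_left _ _ _)
    (fun X Y Y' => Subtype.ext <| (isSymmetric_symBracket _ _).ext_polyEval
      ((HVF Ω (k + l)).add_mem (symBracket_mem_HVF X.2 Y.2) (symBracket_mem_HVF X.2 Y'.2)).1
      fun t => by
        simp only [Submodule.coe_add, polyEval_add, polyEval_symBracket]
        exact map_add (lieBrₗ _) _ _)
    (fun c X Y => Subtype.ext <| (isSymmetric_symBracket _ _).ext_polyEval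
      ((HVF Ω (k + l)).smul_mem c (symBracket_mem_HVF X.2 Y.2)).1
      fun t => by
        simp only [Submodule.coe_smul, polyEval_smul, polyEval_symBracket]
        exact map_smul (lieBrₗ _) _ _)

lemma polyEval_hvfBracket (Ω : Structure N n P) {k l : ℕ} (X : HVF Ω k) (Y : HVF Ω l)
    (t : Fin n → ℝ) :
    polyEval t (hvfBracket Ω k l X Y).1 = lieBr (polyEval t X.1) (polyEval t Y.1) :=
  polyEval_symBracket _ _ t

/-- The bracket `SHV^{k+1} × SHV^{l+1} → SHV^{k+l+1}`. -/
def rankBracket (Ω : Structure N n P) (k l : ℕ) :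
    SHVrank Ω k →ₗ[ℝ] SHVrank Ω l →ₗ[ℝ] SHVrank Ω (k + l) :=
  LinearMap.liftQ₂ _ _ ((hvfBracket Ω k l).compr₂ (Submodule.mkQ _))
    (fun _ hX => LinearMap.ext fun Y => (Submodule.Quotient.mk_eq_zero _).2
      (symBracket_mem_kernelEq_left hX Y.2))
    (fun _ hY => LinearMap.ext fun X => (Submodule.Quotient.mk_eq_zero _).2
      (symBracket_mem_kernelEq_right X.2 hY))

lemma rankBracket_cls (Ω : Structure N n P) {k l : ℕ} (X : HVF Ω k) (Y : HVF Ω l) :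
    rankBracket Ω k l (cls Ω X) (cls Ω Y) = cls Ω (hvfBracket Ω k l X Y) := rfl

/-! ### The Lie algebra identities on the direct sum -/

/-- The left-hand side of the Jacobi identity, as a trilinear map. -/
def jacobiator {L : Type*} [AddCommMonoid L] [Module ℝ L] (B : L →ₗ[ℝ] L →ₗ[ℝ] L) :
    L →ₗ[ℝ] L →ₗ[ℝ] L →ₗ[ℝ] L :=
  LinearMap.mk₂ ℝ (fun x y => B x ∘ₗ B y + B y ∘ₗ B.flip x + B.flip (B x y))
    (fun x x' y => by ext z; simp; abel) (fun c x y => by ext z; simp)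
    (fun x y y' => by ext z; simp; abel) (fun c x y => by ext z; simp)

lemma jacobiator_apply {L : Type*} [AddCommMonoid L] [Module ℝ L] (B : L →ₗ[ℝ] L →ₗ[ℝ] L)
    (x y z : L) : jacobiator B x y z = B x (B y z) + B y (B z x) + B z (B x y) := rfl

/-- The bracket on `SHV`. -/
def shvBracket (Ω : Structure N n P) : SHV Ω →ₗ[ℝ] SHV Ω →ₗ[ℝ] SHV Ω :=
  -- Each `flip` moves the argument to be extended from homogeneous components to the front.
  DirectSum.toModule ℝ ℕ _ fun k => LinearMap.flip <| DirectSum.toModule ℝ ℕ _ fun l =>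
    LinearMap.flip <| (rankBracket Ω k l).compr₂ (DirectSum.lof ℝ ℕ (SHVrank Ω) (k + l))

lemma shvBracket_lof_cls (Ω : Structure N n P) {k l : ℕ} (X : HVF Ω k) (Y : HVF Ω l) :
    shvBracket Ω (DirectSum.lof ℝ ℕ (SHVrank Ω) k (cls Ω X))
      (DirectSum.lof ℝ ℕ (SHVrank Ω) l (cls Ω Y)) =
    DirectSum.lof ℝ ℕ (SHVrank Ω) (k + l) (cls Ω (hvfBracket Ω k l X Y)) := by
  simp only [shvBracket, DirectSum.toModule_lof, LinearMap.flip_apply, LinearMap.compr₂_apply,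
    rankBracket_cls]

/-- Linear maps on `SHV` are determined by their values on the classes of Hamiltonian vector
fields. -/
lemma shv_linearMap_ext {Ω : Structure N n P} {L : Type*} [AddCommMonoid L] [Module ℝ L]
    {F G : SHV Ω →ₗ[ℝ] L}
    (h : ∀ (k : ℕ) (X : HVF Ω k), F (DirectSum.lof ℝ ℕ (SHVrank Ω) k (cls Ω X)) =
      G (DirectSum.lof ℝ ℕ (SHVrank Ω) k (cls Ω X))) : F = G := by
  refine DirectSum.linearMap_ext ℝ fun k => LinearMap.ext fun a => ?_
  obtain ⟨X, rfl⟩ := Submodule.Quotient.mk_surjective _ a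
  exact h k X

/-- Degrees such as `k + l` and `l + k` agree only propositionally, so the identity is stated inside
`SHV`, with the equality of degrees as a hypothesis. The representatives themselves cancel, by
polarization. -/
lemma lof_cls_add_eq_zero {Ω : Structure N n P} {i j : ℕ} (hj : j = i) (X : HVF Ω i)
    (Y : HVF Ω j) (h : ∀ t, polyEval t X.1 + polyEval t Y.1 = 0) :
    DirectSum.lof ℝ ℕ (SHVrank Ω) i (cls Ω X) + DirectSum.lof ℝ ℕ (SHVrank Ω) j (cls Ω Y) = 0 := by
  subst hj
  have h0 : X + Y = 0 := Subtype.ext <| (X + Y).2.1.ext_polyEval (HVF Ω j).zero_mem.1 fun t => by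
    rw [Submodule.coe_add, polyEval_add, h t]
    simp [polyEval]
  rw [← map_add, ← Submodule.Quotient.mk_add, h0, Submodule.Quotient.mk_zero, map_zero]

lemma lof_cls_add_add_eq_zero {Ω : Structure N n P} {i j k : ℕ} (hj : j = i) (hk : k = i)
    (X : HVF Ω i) (Y : HVF Ω j) (Z : HVF Ω k)
    (h : ∀ t, polyEval t X.1 + polyEval t Y.1 + polyEval t Z.1 = 0) :
    DirectSum.lof ℝ ℕ (SHVrank Ω) i (cls Ω X) + DirectSum.lof ℝ ℕ (SHVrank Ω) j (cls Ω Y) +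
      DirectSum.lof ℝ ℕ (SHVrank Ω) k (cls Ω Z) = 0 := by
  subst hj
  rw [← map_add, ← Submodule.Quotient.mk_add]
  refine lof_cls_add_eq_zero hk (X + Y) Z fun t => ?_
  rw [← h t, Submodule.coe_add, polyEval_add]

/-- Halving by a real scalar makes this valid without subtraction. -/
lemma eq_zero_of_add_self_eq_zero {L : Type*} [AddCommMonoid L] [Module ℝ L] {a : L}
    (h : a + a = 0) : a = 0 := by
  rw [← inv_smul_smul₀ (two_ne_zero : (2 : ℝ) ≠ 0) a, two_smul, h, smul_zero]

lemma isLieBracket_shvBracket (Ω : Structure N n P) : IsLieBracket (shvBracket Ω) where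
  alternating x := by
    -- Skew symmetry, unlike `B x x = 0`, is bilinear and so can be tested on homogeneous classes;
    -- dividing by `2` gives the alternating property.
    have h : shvBracket Ω + (shvBracket Ω).flip = 0 := by
      refine shv_linearMap_ext fun k X => ?_
      refine shv_linearMap_ext fun l Y => ?_
      simp only [LinearMap.add_apply, LinearMap.flip_apply, LinearMap.zero_apply,
        shvBracket_lof_cls]
      refine lof_cls_add_eq_zero (add_comm l k) _ _ fun t => ?_
      rw [polyEval_hvfBracket, polyEval_hvfBracket, lieBr_swap, neg_add_cancel]
    have hx : shvBracket Ω x x + shvBracket Ω x x = 0 :=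
      LinearMap.congr_fun (LinearMap.congr_fun h x) x
    exact eq_zero_of_add_self_eq_zero hx
  jacobi x y z := by
    -- As an equation between trilinear maps, the Jacobi identity need only be tested on homogeneous
    -- classes.
    suffices h : jacobiator (shvBracket Ω) = 0 from
      LinearMap.congr_fun (LinearMap.congr_fun (LinearMap.congr_fun h x) y) z
    refine shv_linearMap_ext fun k X => ?_
    refine shv_linearMap_ext fun l Y => ?_
    refine shv_linearMap_ext fun m Z => ?_
    rw [jacobiator_apply]
    simp only [shvBracket_lof_cls, LinearMap.zero_apply]
    refine lof_cls_add_add_eq_zero (by omega) (by omega) _ _ _ fun t => ?_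
    simp only [polyEval_hvfBracket]
    exact lieBr_jacobi _ _ _

end Bracket

end NSymplectic

end

theorem mainTheorem8 {N n : ℕ} (hn : 1 ≤ n) (hnN : n ≤ N)
    {P : Type*} [TopologicalSpace P] [ChartedSpace (EuclideanSpace ℝ (Fin N)) P]
    [IsManifold (𝓡 N) ∞ P] (Ω : NSymplectic.Structure N n P) :
    -- the symmetrized Lie bracket of Hamiltonian representatives is Hamiltonian,
    ∃ closure : ∀ (k l : ℕ) (X : NSymplectic.HVF Ω k) (Y : NSymplectic.HVF Ω l),
        NSymplectic.symBracket X.1 Y.1 ∈ NSymplectic.HVF Ω (k + l),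
      -- its class depends only on the classes of the two representatives,
      (∀ (k l : ℕ) (X X' : NSymplectic.HVF Ω k) (Y Y' : NSymplectic.HVF Ω l),
        NSymplectic.cls Ω X = NSymplectic.cls Ω X' →
        NSymplectic.cls Ω Y = NSymplectic.cls Ω Y' →
        NSymplectic.cls Ω ⟨NSymplectic.symBracket X.1 Y.1, closure k l X Y⟩ =
          NSymplectic.cls Ω ⟨NSymplectic.symBracket X'.1 Y'.1, closure k l X' Y'⟩) ∧
      -- and its bilinear extension to the direct sum is a Lie bracket
      ∃! B : NSymplectic.SHV Ω →ₗ[ℝ] NSymplectic.SHV Ω →ₗ[ℝ] NSymplectic.SHV Ω,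
        (∀ (k l : ℕ) (X : NSymplectic.HVF Ω k) (Y : NSymplectic.HVF Ω l),
          B (DirectSum.lof ℝ ℕ (NSymplectic.SHVrank Ω) k (NSymplectic.cls Ω X))
              (DirectSum.lof ℝ ℕ (NSymplectic.SHVrank Ω) l (NSymplectic.cls Ω Y)) =
            DirectSum.lof ℝ ℕ (NSymplectic.SHVrank Ω) (k + l)
              (NSymplectic.cls Ω ⟨NSymplectic.symBracket X.1 Y.1, closure k l X Y⟩)) ∧
        NSymplectic.IsLieBracket B := by
  refine ⟨fun k l X Y => NSymplectic.symBracket_mem_HVF X.2 Y.2, fun k l X X' Y Y' hX hY => ?_,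
    NSymplectic.shvBracket Ω,
    ⟨fun k l X Y => NSymplectic.shvBracket_lof_cls Ω X Y, NSymplectic.isLieBracket_shvBracket Ω⟩,
    fun B hB => ?_⟩
  -- Both sides are values of `rankBracket`, already defined on the quotients, by definitional
  -- unfolding.
  · exact congrArg₂ (fun a b => NSymplectic.rankBracket Ω k l a b) hX hY
  -- Uniqueness: the homogeneous classes span `SHV`, and the prescribed values on them fix `B`.
  · refine NSymplectic.shv_linearMap_ext fun k X => ?_
    refine NSymplectic.shv_linearMap_ext fun l Y => ?_
    exact (hB.1 k l X Y).trans (NSymplectic.shvBracket_lof_cls Ω X Y).symm
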